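/- Let $T_0=(A_0,B_0,C_0)$ be a non-degenerate triangle in the Euclidean plane, and let $\xi_a^{(n)},\xi_b^{(n)},\xi_c^{(n)}$, $n\ge 1$, be independent random variables, each uniform on $[0,1]$. Given $T_{n-1}=(A_{n-1},B_{n-1},C_{n-1})$, let $T_n=(A_n,B_n,C_n)$ be the triangle with one random vertex on each side of $T_{n-1}$: $$A_n=B_{n-1}+\xi_a^{(n)}(C_{n-1}-B_{n-1}),\quad B_n=C_{n-1}+\xi_b^{(n)}(A_{n-1}-C_{n-1}),\quad C_n=A_{n-1}+\xi_c^{(n)}(B_{n-1}-A_{n-1}).$$ Almost surely all triangles $T_n$ are non-degenerate. Let $(x_n,y_n)$ be the normalized apex of $T_n$: after relabelling its vertices, $T_n$ is similar to the triangle with vertices $A=(0,0)$, $B=(1,0)$, $C=(x_n,y_n)$ with $y_n\ge 0$ and $|AB|\ge|AC|\ge|BC|$. Then $x_n$ converges in distribution, as $n\to\infty$, to the uniform distribution on $[1/2,1]$. -/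

import Mathlib

open MeasureTheory ProbabilityTheory Filter

/-- The Euclidean plane. -/
abbrev Plane : Type := EuclideanSpace ℝ (Fin 2)

/-- The triangle `A₁B₁C₁` obtained from the triangle `T = (A, B, C)` by choosing `A₁` on `BC`,
`B₁` on `CA` and `C₁` on `AB` with `A₁ = B + t 0 • (C - B)`, `B₁ = C + t 1 • (A - C)`,
`C₁ = A + t 2 • (B - A)` (the index `i + 1` is taken modulo `3`). -/
noncomputable def subtriangle (T : Fin 3 → Plane) (t : Fin 3 → ℝ) : Fin 3 → Plane :=
  fun i => AffineMap.lineMap (T (i + 1)) (T (i + 2)) (t i)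

/-- The sequence of triangles that starts at `T₀`; the `n`-th subdivision uses the
parameters `ξ n`. -/
noncomputable def triangleSeq (T₀ : Fin 3 → Plane) (ξ : ℕ → Fin 3 → ℝ) : ℕ → Fin 3 → Plane
  | 0 => T₀
  | n + 1 => subtriangle (triangleSeq T₀ ξ n) (ξ n)

/-- The triangle with vertices `A = (0, 0)`, `B = (1, 0)`, `C = (x, y)`. -/
noncomputable def standardTriangle (x y : ℝ) : Fin 3 → Plane :=
  ![!₂[0, 0], !₂[1, 0], !₂[x, y]]

/-- `(x, y)` is the normalized apex of the triangle `T`: after a relabelling of its vertices,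
`T` is similar to the triangle `A = (0, 0)`, `B = (1, 0)`, `C = (x, y)`, where `C` lies in
the closed upper half-plane, `|AB| ≥ |AC| ≥ |BC|`. -/
def IsNormalizedApex (T : Fin 3 → Plane) (x y : ℝ) : Prop :=
  0 ≤ y ∧
  dist (standardTriangle x y 0) (standardTriangle x y 2) ≤
    dist (standardTriangle x y 0) (standardTriangle x y 1) ∧
  dist (standardTriangle x y 1) (standardTriangle x y 2) ≤
    dist (standardTriangle x y 0) (standardTriangle x y 2) ∧
  ∃ σ : Equiv.Perm (Fin 3), Similar (T ∘ σ) (standardTriangle x y)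

open Classical in
/-- The horizontal coordinate `x` of the normalized apex `(x, y)` of a triangle (with the
value `0` if all three vertices coincide, the only case without a normalized apex). -/
noncomputable def normalizedX (T : Fin 3 → Plane) : ℝ :=
  if h : ∃ x y, IsNormalizedApex T x y then h.choose else 0

lemma dist_standardTriangle (x y : ℝ) :
    dist (standardTriangle x y 0) (standardTriangle x y 1) = 1 ∧
    dist (standardTriangle x y 0) (standardTriangle x y 2) = √(x ^ 2 + y ^ 2) ∧
    dist (standardTriangle x y 1) (standardTriangle x y 2) = √((1 - x) ^ 2 + y ^ 2) := by
  refine ⟨?_, ?_, ?_⟩ <;>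
    simp [standardTriangle, EuclideanSpace.dist_eq, Fin.sum_univ_two, Real.dist_eq]

/-- The normalized apex exists unless all three vertices coincide. -/
lemma exists_isNormalizedApex {T : Fin 3 → Plane} (hT : ∃ i j, T i ≠ T j) :
    ∃ x y, IsNormalizedApex T x y := by
  obtain ⟨σ, h1, h2⟩ : ∃ σ : Equiv.Perm (Fin 3),
      dist (T (σ 0)) (T (σ 2)) ≤ dist (T (σ 0)) (T (σ 1)) ∧
      dist (T (σ 1)) (T (σ 2)) ≤ dist (T (σ 0)) (T (σ 2)) := by
    have key : ∀ i j k : Fin 3, i ≠ j → i ≠ k → j ≠ k →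
        dist (T i) (T k) ≤ dist (T i) (T j) → dist (T j) (T k) ≤ dist (T i) (T k) →
        ∃ σ : Equiv.Perm (Fin 3),
          dist (T (σ 0)) (T (σ 2)) ≤ dist (T (σ 0)) (T (σ 1)) ∧
          dist (T (σ 1)) (T (σ 2)) ≤ dist (T (σ 0)) (T (σ 2)) := by
      intro i j k hij hik hjk h1 h2
      have hinj : Function.Injective ![i, j, k] := by
        intro a b
        fin_cases a <;> fin_cases b <;> simp [hij, hik, hjk, hij.symm, hik.symm, hjk.symm]
      refine ⟨Equiv.ofBijective _ (Finite.injective_iff_bijective.mp hinj), ?_, ?_⟩ <;>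
        simpa using by assumption
    have c01 := dist_comm (T 0) (T 1)
    have c02 := dist_comm (T 0) (T 2)
    have c12 := dist_comm (T 1) (T 2)
    by_cases a : dist (T 0) (T 1) ≤ dist (T 0) (T 2) <;>
    by_cases b : dist (T 0) (T 1) ≤ dist (T 1) (T 2) <;>
    by_cases c : dist (T 0) (T 2) ≤ dist (T 1) (T 2) <;>
    first
    | exact key 0 1 2 (by decide) (by decide) (by decide) (by linarith) (by linarith)
    | exact key 1 0 2 (by decide) (by decide) (by decide) (by linarith) (by linarith)
    | exact key 0 2 1 (by decide) (by decide) (by decide) (by linarith) (by linarith)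
    | exact key 2 0 1 (by decide) (by decide) (by decide) (by linarith) (by linarith)
    | exact key 1 2 0 (by decide) (by decide) (by decide) (by linarith) (by linarith)
    | exact key 2 1 0 (by decide) (by decide) (by decide) (by linarith) (by linarith)
  set L := dist (T (σ 0)) (T (σ 1)) with hL
  set m := dist (T (σ 0)) (T (σ 2)) with hm
  set s := dist (T (σ 1)) (T (σ 2)) with hs
  have hs0 : 0 ≤ s := dist_nonneg
  have hLpos : 0 < L := by
    by_contra hneg
    have hL0 : L = 0 := le_antisymm (not_lt.mp hneg) dist_nonneg
    have e1 : T (σ 0) = T (σ 1) := dist_eq_zero.mp hL0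
    have e2 : T (σ 0) = T (σ 2) := dist_eq_zero.mp (by rw [← hm]; linarith)
    obtain ⟨i, j, hij⟩ := hT
    have all : ∀ a, T (σ a) = T (σ 0) := by
      intro a
      fin_cases a
      · rfl
      · exact e1.symm
      · exact e2.symm
    exact hij (by
      rw [← σ.apply_symm_apply i, ← σ.apply_symm_apply j, all (σ.symm i), all (σ.symm j)])
  have htri : L ≤ m + s := by
    rw [hL, hm, hs, dist_comm (T (σ 1))]
    exact dist_triangle _ _ _
  have hm0 : 0 ≤ m := hs0.trans h2
  set x := (L ^ 2 + m ^ 2 - s ^ 2) / (2 * L ^ 2) with hx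
  have hx0 : 0 ≤ x := by
    apply div_nonneg _ (by positivity)
    nlinarith
  have hxm : x ≤ m / L := by
    rw [hx, div_le_div_iff₀ (by positivity) hLpos]
    have : L ^ 2 + m ^ 2 - s ^ 2 ≤ 2 * L * m := by nlinarith
    nlinarith
  have hy : 0 ≤ (m / L) ^ 2 - x ^ 2 := by nlinarith
  have hd1 : √(x ^ 2 + √((m / L) ^ 2 - x ^ 2) ^ 2) = m / L := by
    rw [Real.sq_sqrt hy, add_sub_cancel, Real.sqrt_sq (by positivity)]
  have hd2 : √((1 - x) ^ 2 + √((m / L) ^ 2 - x ^ 2) ^ 2) = s / L := by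
    have hx2 : 2 * x = 1 + (m / L) ^ 2 - (s / L) ^ 2 := by
      rw [hx]
      field_simp
    have hsq : (1 - x) ^ 2 + ((m / L) ^ 2 - x ^ 2) = (s / L) ^ 2 := by linear_combination -hx2
    rw [Real.sq_sqrt hy, hsq, Real.sqrt_sq (by positivity)]
  obtain ⟨d01, d02, d12⟩ := dist_standardTriangle x (√((m / L) ^ 2 - x ^ 2))
  rw [hd1] at d02
  rw [hd2] at d12
  refine ⟨x, √((m / L) ^ 2 - x ^ 2), Real.sqrt_nonneg _, ?_, ?_, σ, ?_⟩
  · rw [d01, d02]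
    exact (div_le_one hLpos).mpr h1
  · rw [d12, d02]
    gcongr
  · rw [similar_iff_exists_dist_eq]
    refine ⟨⟨L, hLpos.le⟩, fun h => hLpos.ne' (congrArg NNReal.toReal h), ?_⟩
    have r01 : L = L * 1 := by ring
    have r02 : m = L * (m / L) := by field_simp
    have r12 : s = L * (s / L) := by field_simp
    rw [← d01] at r01
    rw [← d02] at r02
    rw [← d12] at r12
    intro i j
    fin_cases i <;> fin_cases j
    · exact (dist_self _).trans (by rw [dist_self, mul_zero])
    · exact r01
    · exact r02
    · exact (dist_comm _ _).trans (r01.trans (by rw [dist_comm]; rfl))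
    · exact (dist_self _).trans (by rw [dist_self, mul_zero])
    · exact r12
    · exact (dist_comm _ _).trans (r02.trans (by rw [dist_comm]; rfl))
    · exact (dist_comm _ _).trans (r12.trans (by rw [dist_comm]; rfl))
    · exact (dist_self _).trans (by rw [dist_self, mul_zero])

/-- The horizontal coordinate of the normalized apex in terms of the side lengths of the
triangle; in particular, it is unique. -/
lemma IsNormalizedApex.x_eq {T : Fin 3 → Plane} {x y : ℝ} (h : IsNormalizedApex T x y) :
    x = (dist (T 1) (T 2) ^ 2 + dist (T 2) (T 0) ^ 2 + dist (T 0) (T 1) ^ 2 -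
        2 * min (dist (T 1) (T 2)) (min (dist (T 2) (T 0)) (dist (T 0) (T 1))) ^ 2) /
      (2 * max (dist (T 1) (T 2)) (max (dist (T 2) (T 0)) (dist (T 0) (T 1))) ^ 2) := by
  obtain ⟨-, h1, h2, σ, hσ⟩ := h
  obtain ⟨r, hr, hd⟩ := similar_iff_exists_dist_eq.mp hσ
  obtain ⟨d01, d02, d12⟩ := dist_standardTriangle x y
  have e01 := hd 0 1
  have e02 := hd 0 2
  have e12 := hd 1 2
  have hrpos : (0 : ℝ) < r := by positivity
  rw [d01, d02] at h1
  rw [d02, d12] at h2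
  rw [d01] at e01
  rw [d02] at e02
  rw [d12] at e12
  have q1 : √(x ^ 2 + y ^ 2) ^ 2 = x ^ 2 + y ^ 2 := Real.sq_sqrt (by positivity)
  have q2 : √((1 - x) ^ 2 + y ^ 2) ^ 2 = (1 - x) ^ 2 + y ^ 2 := Real.sq_sqrt (by positivity)
  set u := √(x ^ 2 + y ^ 2)
  set v := √((1 - x) ^ 2 + y ^ 2)
  have hxuv : x = (1 + u ^ 2 - v ^ 2) / 2 := by rw [q1, q2]; ring
  simp only [Function.comp_apply] at e01 e02 e12
  have i1 : (r : ℝ) * v ≤ r * u := by gcongr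
  have i2 : (r : ℝ) * u ≤ r * 1 := by gcongr
  have i3 : (r : ℝ) * v ≤ r * 1 := i1.trans i2
  have f01 := e01
  have f02 := e02
  have f12 := e12
  rw [dist_comm] at f01 f02 f12
  have n01 : σ 0 ≠ σ 1 := by simp
  have n02 : σ 0 ≠ σ 2 := by simp
  have n12 : σ 1 ≠ σ 2 := by simp
  generalize σ 0 = a at *
  generalize σ 1 = b at *
  generalize σ 2 = c at *
  rw [hxuv]
  fin_cases a <;> fin_cases b <;> fin_cases c <;> first
    | exact absurd rfl n01
    | exact absurd rfl n02
    | exact absurd rfl n12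
    | (simp only [Fin.zero_eta, Fin.mk_one, Fin.reduceFinMk] at e01 e02 e12 f01 f02 f12
       simp only [e01, e02, e12, f01, f02, f12, i1, i2, i3, min_eq_left, min_eq_right,
         max_eq_left, max_eq_right]
       field_simp
       ring)

/-- `normalizedX T` is the horizontal coordinate of every normalized apex of `T`. -/
lemma IsNormalizedApex.normalizedX_eq {T : Fin 3 → Plane} {x y : ℝ}
    (h : IsNormalizedApex T x y) : normalizedX T = x := by
  have hex : ∃ x y, IsNormalizedApex T x y := ⟨x, y, h⟩
  rw [normalizedX, dif_pos hex]
  obtain ⟨y', hy'⟩ := hex.choose_spec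
  rw [hy'.x_eq, h.x_eq]

/-!
Project the triangles to the first axis. The projections form the same random subdivision, now of
degenerate triangles on the line. For these the shape is exactly uniform after a single step:
given the two extreme points of the new triple, the middle one is uniform between them.

It remains to see that the triangles flatten, that is, that `area / width ^ 2` tends to `0` in
probability, where `width` is the length of the projection. In one step the expectation of
`√area` gets multiplied by at most `53 / 108`, while the expectation of `1 / width` at most
doubles, so by the Cauchy–Schwarz inequality the expectation of `√(√area / width)` decays like
`(53 / 54) ^ (n / 2)`.
-/

/-- The uniform distribution on `[0, 1]`. -/
noncomputable def unitUniform : Measure ℝ := volume.restrict (Set.Icc 0 1)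

instance : IsProbabilityMeasure unitUniform := ⟨by simp [unitUniform]⟩

lemma measurePreserving_one_sub_unitUniform :
    MeasurePreserving (fun a : ℝ => 1 - a) unitUniform unitUniform := by
  have h := (Measure.measurePreserving_sub_left (volume : Measure ℝ) 1).restrict_preimage
    (s := Set.Icc (0 : ℝ) 1) measurableSet_Icc
  simpa [unitUniform] using h

lemma restrict_Icc_add_restrict_Icc {p q r : ℝ} (hpq : p ≤ q) (hqr : q ≤ r) :
    volume.restrict (Set.Icc p q) + volume.restrict (Set.Icc q r) =
      (volume.restrict (Set.Icc p r) : Measure ℝ) := by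
  rw [← restrict_Ioc_eq_restrict_Icc (a := q), ← Set.Icc_union_Ioc_eq_Icc hpq hqr,
    Measure.restrict_union _ measurableSet_Ioc]
  exact Set.disjoint_left.2 fun _ hc hc' => hc'.1.not_ge hc.2

/-- The uniform distribution on the segment with endpoints `p` and `q`, in either order; it is
the Dirac mass at `p` when `p = q`. -/
noncomputable def segmentUniform (p q : ℝ) : Measure ℝ :=
  unitUniform.map (AffineMap.lineMap p q)

lemma measurable_lineMap (p q : ℝ) : Measurable (AffineMap.lineMap p q : ℝ → ℝ) :=
  AffineMap.lineMap_continuous.measurable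

instance (p q : ℝ) : IsProbabilityMeasure (segmentUniform p q) :=
  Measure.isProbabilityMeasure_map (measurable_lineMap p q).aemeasurable

lemma segmentUniform_comm (p q : ℝ) : segmentUniform p q = segmentUniform q p := by
  rw [segmentUniform, segmentUniform, ← measurePreserving_one_sub_unitUniform.map_eq,
    Measure.map_map (measurable_lineMap _ _) measurePreserving_one_sub_unitUniform.measurable,
    measurePreserving_one_sub_unitUniform.map_eq]
  congr 1
  ext a
  exact AffineMap.lineMap_apply_one_sub p q a

lemma ofReal_smul_segmentUniform {p q : ℝ} (h : p ≤ q) :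
    ENNReal.ofReal (q - p) • segmentUniform p q = volume.restrict (Set.Icc p q) := by
  rcases h.eq_or_lt with rfl | h
  · simp
  have hpos : 0 < q - p := sub_pos.2 h
  have hfun : (AffineMap.lineMap p q : ℝ → ℝ) = (fun a => p + a) ∘ fun a => a * (q - p) := by
    ext a
    simp [AffineMap.lineMap_apply, add_comm]
  have hmap : volume.map (AffineMap.lineMap p q : ℝ → ℝ) =
      ENNReal.ofReal (q - p)⁻¹ • (volume : Measure ℝ) := by
    rw [hfun, ← Measure.map_map (by fun_prop) (by fun_prop),
      Real.map_volume_mul_right hpos.ne', Measure.map_smul, map_add_left_eq_self,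
      abs_of_pos (inv_pos.2 hpos)]
  have hpre : (AffineMap.lineMap p q : ℝ → ℝ) ⁻¹' Set.Icc p q = Set.Icc 0 1 := by
    simp [hfun, Set.preimage_comp, Set.preimage_mul_const_Icc₀ _ _ hpos, hpos.ne']
  rw [segmentUniform, unitUniform, ← hpre,
    ← Measure.restrict_map (measurable_lineMap p q) measurableSet_Icc, hmap,
    Measure.restrict_smul, smul_smul, ← ENNReal.ofReal_mul hpos.le, mul_inv_cancel₀ hpos.ne',
    ENNReal.ofReal_one, one_smul]

lemma ae_segmentUniform_mem_Icc {p q : ℝ} (h : p ≤ q) :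
    ∀ᵐ c ∂segmentUniform p q, c ∈ Set.Icc p q := by
  refine (ae_map_iff (measurable_lineMap p q).aemeasurable measurableSet_Icc).2 ?_
  filter_upwards [ae_restrict_mem measurableSet_Icc] with s hs
  exact (convex_Icc p q).lineMap_mem (Set.left_mem_Icc.2 h) (Set.right_mem_Icc.2 h) hs

section Symmetrization

variable {α : Type*} [MeasurableSpace α] [LinearOrder α] [TopologicalSpace α]
  [OrderClosedTopology α] [SecondCountableTopology α] [OpensMeasurableSpace α]
  {μ : Measure α} [SFinite μ] {g : α → α → ENNReal}

lemma lintegral_lintegral_Iic_eq_lintegral_lintegral_Ici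
    (hg : Measurable (Function.uncurry g)) :
    ∫⁻ a, ∫⁻ b in Set.Iic a, g a b ∂μ ∂μ = ∫⁻ b, ∫⁻ a in Set.Ici b, g a b ∂μ ∂μ := by
  have hm : Measurable fun z : α × α => (Set.Iic z.1).indicator (g z.1) z.2 := by
    convert hg.indicator (measurableSet_le measurable_snd measurable_fst) with z
    simp [Set.indicator_apply, Function.uncurry]
  simp_rw [← lintegral_indicator measurableSet_Iic, ← lintegral_indicator measurableSet_Ici]
  rw [lintegral_lintegral_swap hm.aemeasurable]
  rfl

variable [NullSingletonClass μ]

lemma lintegral_lintegral_eq_two_mul_lintegral_Ici (hg : Measurable (Function.uncurry g))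
    (hsymm : ∀ a b, g a b = g b a) :
    ∫⁻ a, ∫⁻ b, g a b ∂μ ∂μ = 2 * ∫⁻ a, ∫⁻ b in Set.Ici a, g a b ∂μ ∂μ := by
  have hm : Measurable fun a => ∫⁻ b in Set.Ici a, g a b ∂μ := by
    simp_rw [← lintegral_indicator measurableSet_Ici]
    refine Measurable.lintegral_prod_right' (f := fun z : α × α =>
      (Set.Ici z.1).indicator (g z.1) z.2) ?_
    convert hg.indicator (measurableSet_le measurable_fst measurable_snd) with z
    simp [Set.indicator_apply, Function.uncurry]
  calc ∫⁻ a, ∫⁻ b, g a b ∂μ ∂μ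
      = ∫⁻ a, (∫⁻ b in Set.Ici a, g a b ∂μ) + ∫⁻ b in Set.Iic a, g a b ∂μ ∂μ := by
        refine lintegral_congr fun a => ?_
        rw [← lintegral_add_compl (g a) (measurableSet_Ici (a := a)), Set.compl_Ici,
          restrict_Iio_eq_restrict_Iic]
    _ = 2 * ∫⁻ a, ∫⁻ b in Set.Ici a, g a b ∂μ ∂μ := by
        rw [lintegral_add_left hm, lintegral_lintegral_Iic_eq_lintegral_lintegral_Ici hg, two_mul]
        simp_rw [fun a b => hsymm b a]

lemma lintegral_lintegral_eq_two_mul_lintegral_Iic (hg : Measurable (Function.uncurry g))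
    (hsymm : ∀ a b, g a b = g b a) :
    ∫⁻ a, ∫⁻ b, g a b ∂μ ∂μ = 2 * ∫⁻ a, ∫⁻ b in Set.Iic a, g a b ∂μ ∂μ := by
  rw [lintegral_lintegral_eq_two_mul_lintegral_Ici hg hsymm,
    lintegral_lintegral_Iic_eq_lintegral_lintegral_Ici hg]
  simp_rw [hsymm]

end Symmetrization

lemma lintegral_Icc {p q : ℝ} (h : p ≤ q) {g : ℝ → ENNReal} (hg : Measurable g) :
    ∫⁻ c in Set.Icc p q, g c =
      ENNReal.ofReal (q - p) * ∫⁻ s, g (AffineMap.lineMap p q s) ∂unitUniform := by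
  rw [← ofReal_smul_segmentUniform h, lintegral_smul_measure, segmentUniform,
    lintegral_map hg (measurable_lineMap p q), smul_eq_mul]

lemma segmentUniform_of_lt {p q : ℝ} (h : p < q) :
    segmentUniform p q = (ENNReal.ofReal (q - p))⁻¹ • volume.restrict (Set.Icc p q) := by
  rw [← ofReal_smul_segmentUniform h.le, smul_smul,
    ENNReal.inv_mul_cancel (by simpa using h) ENNReal.ofReal_ne_top, one_smul]

lemma lintegral_segmentUniform_lintegral_Icc_eq_right {p q : ℝ} (h : p ≤ q)
    {g : ℝ → ℝ → ENNReal} (hg : Measurable (Function.uncurry g)) (hsymm : ∀ a b, g a b = g b a) :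
    ∫⁻ a, (∫⁻ b in Set.Icc p q, g a b) ∂segmentUniform p q =
      2 * ∫⁻ a, (∫⁻ b in Set.Icc a q, g a b) ∂segmentUniform p q := by
  have hinter : ∫⁻ a, (∫⁻ b in Set.Icc a q, g a b) ∂segmentUniform p q =
      ∫⁻ a, (∫⁻ b in Set.Ici a ∩ Set.Icc p q, g a b) ∂segmentUniform p q := by
    refine lintegral_congr_ae ?_
    filter_upwards [ae_segmentUniform_mem_Icc h] with a ha
    congr 2
    ext b
    exact ⟨fun hb => ⟨hb.1, ha.1.trans hb.1, hb.2⟩, fun hb => ⟨hb.1, hb.2.2⟩⟩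
  rw [hinter]
  rcases h.eq_or_lt with rfl | hlt
  · simp [Measure.restrict_eq_zero.2 (measure_mono_null Set.inter_subset_right _)]
  · simp_rw [segmentUniform_of_lt hlt, lintegral_smul_measure,
      ← Measure.restrict_restrict measurableSet_Ici]
    rw [lintegral_lintegral_eq_two_mul_lintegral_Ici hg hsymm, smul_eq_mul, smul_eq_mul,
      mul_left_comm]

lemma lintegral_segmentUniform_lintegral_Icc_eq_left {p q : ℝ} (h : p ≤ q)
    {g : ℝ → ℝ → ENNReal} (hg : Measurable (Function.uncurry g)) (hsymm : ∀ a b, g a b = g b a) :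
    ∫⁻ a, (∫⁻ b in Set.Icc p q, g a b) ∂segmentUniform p q =
      2 * ∫⁻ a, (∫⁻ b in Set.Icc p a, g a b) ∂segmentUniform p q := by
  have hinter : ∫⁻ a, (∫⁻ b in Set.Icc p a, g a b) ∂segmentUniform p q =
      ∫⁻ a, (∫⁻ b in Set.Iic a ∩ Set.Icc p q, g a b) ∂segmentUniform p q := by
    refine lintegral_congr_ae ?_
    filter_upwards [ae_segmentUniform_mem_Icc h] with a ha
    congr 2
    ext b
    exact ⟨fun hb => ⟨hb.2, hb.1, hb.2.trans ha.2⟩, fun hb => ⟨hb.2.1, hb.1⟩⟩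
  rw [hinter]
  rcases h.eq_or_lt with rfl | hlt
  · simp [Measure.restrict_eq_zero.2 (measure_mono_null Set.inter_subset_right _)]
  · simp_rw [segmentUniform_of_lt hlt, lintegral_smul_measure,
      ← Measure.restrict_restrict measurableSet_Iic]
    rw [lintegral_lintegral_eq_two_mul_lintegral_Iic hg hsymm, smul_eq_mul, smul_eq_mul,
      mul_left_comm]

lemma lintegral_pi_fin_three {α : Type*} [MeasurableSpace α] (μ : Fin 3 → Measure α)
    [∀ i, SigmaFinite (μ i)] {f : (Fin 3 → α) → ENNReal} (hf : Measurable f) :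
    ∫⁻ x, f x ∂Measure.pi μ = ∫⁻ a, ∫⁻ b, ∫⁻ c, f ![a, b, c] ∂μ 2 ∂μ 1 ∂μ 0 := by
  have hcons := (measurePreserving_piFinSuccAbove μ 0).symm
  have hpair := (measurePreserving_finTwoArrow_vec (μ 1) (μ 2)).symm
  have htail : (fun j => μ (Fin.succAbove 0 j)) = ![μ 1, μ 2] := by
    ext j
    fin_cases j <;> rfl
  rw [← hcons.lintegral_comp hf, lintegral_prod _ (by fun_prop), htail]
  refine lintegral_congr fun a => ?_
  rw [← hpair.lintegral_comp_emb (MeasurableEquiv.measurableEmbedding _),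
    lintegral_prod _ (by fun_prop)]
  refine lintegral_congr fun b => lintegral_congr fun c => congrArg f ?_
  ext i
  fin_cases i <;> rfl

lemma pi_map_comp_perm {ι α : Type*} [Fintype ι] [MeasurableSpace α] (μ : ι → Measure α)
    [∀ i, SigmaFinite (μ i)] (σ : Equiv.Perm ι) :
    (Measure.pi μ).map (· ∘ σ) = Measure.pi fun i => μ (σ i) := by
  have h := Measure.pi_map_piCongrLeft σ.symm (fun i => μ (σ i))
  simp only [Equiv.apply_symm_apply] at h
  rw [← h]
  congr 1
  ext x i
  simpa using (MeasurableEquiv.piCongrLeft_apply_apply (β := fun _ => α) σ.symm x (σ i)).symm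

/-- The lengths of the sides of a triangle, the `i`-th side being opposite to the vertex `i`. -/
noncomputable def sideLengths {X : Type*} [PseudoMetricSpace X] (T : Fin 3 → X) : Fin 3 → ℝ :=
  fun i => dist (T (i + 1)) (T (i + 2))

lemma perm_fin_three_cyclic_or_anticyclic : ∀ σ : Equiv.Perm (Fin 3),
    (∀ i, σ (i + 1) = σ i + 1 ∧ σ (i + 2) = σ i + 2) ∨
      (∀ i, σ (i + 1) = σ i + 2 ∧ σ (i + 2) = σ i + 1) := by
  decide

lemma sideLengths_comp_perm {X : Type*} [PseudoMetricSpace X] (T : Fin 3 → X)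
    (σ : Equiv.Perm (Fin 3)) : sideLengths (T ∘ σ) = sideLengths T ∘ σ := by
  ext i
  rcases perm_fin_three_cyclic_or_anticyclic σ with h | h
  · simp only [sideLengths, Function.comp_apply, h]
  · simp only [sideLengths, Function.comp_apply, h, dist_comm]

lemma measurable_sideLengths {X : Type*} [PseudoMetricSpace X] [SecondCountableTopology X]
    [MeasurableSpace X] [OpensMeasurableSpace X] :
    Measurable (sideLengths : (Fin 3 → X) → Fin 3 → ℝ) := by
  unfold sideLengths
  fun_prop

lemma iInf_fin_three (d : Fin 3 → ℝ) : ⨅ i, d i = min (d 0) (min (d 1) (d 2)) := by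
  rw [← Finset.inf'_univ_eq_ciInf]
  rfl

lemma norm_fin_three (d : Fin 3 → ℝ) : ‖d‖ = max |d 0| (max |d 1| |d 2|) := by
  refine le_antisymm ((pi_norm_le_iff_of_nonneg (by positivity)).2 fun i => ?_) ?_
  · fin_cases i <;> simp
  · exact max_le (norm_le_pi_norm d 0) (max_le (norm_le_pi_norm d 1) (norm_le_pi_norm d 2))

lemma norm_comp_perm {ι : Type*} [Fintype ι] (d : ι → ℝ) (σ : Equiv.Perm ι) : ‖d ∘ σ‖ = ‖d‖ := by
  rw [Pi.norm_def, Pi.norm_def, Finset.sup_univ_eq_ciSup, Finset.sup_univ_eq_ciSup]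
  exact congrArg _ (σ.iSup_comp (g := fun i => ‖d i‖₊))

/-- The horizontal coordinate of the normalized apex of a triangle with side lengths `d`; the sup
norm `‖d‖` is the longest side. -/
noncomputable def apexX (d : Fin 3 → ℝ) : ℝ :=
  (∑ i, d i ^ 2 - 2 * (⨅ i, d i) ^ 2) / (2 * ‖d‖ ^ 2)

lemma apexX_comp_perm (d : Fin 3 → ℝ) (σ : Equiv.Perm (Fin 3)) : apexX (d ∘ σ) = apexX d := by
  simp only [apexX, norm_comp_perm, Function.comp_apply, σ.iInf_comp (g := d),
    Equiv.sum_comp σ fun i => d i ^ 2]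

lemma apexX_smul {c : ℝ} (hc : 0 < c) (d : Fin 3 → ℝ) : apexX (c • d) = apexX d := by
  simp only [apexX, norm_smul, Real.norm_of_nonneg hc.le, Pi.smul_apply, smul_eq_mul, mul_pow,
    ← Real.mul_iInf_of_nonneg hc.le, ← Finset.mul_sum]
  rw [mul_left_comm 2, mul_left_comm 2, ← mul_sub, mul_div_mul_left _ _ (by positivity)]

lemma continuous_iInf_real {ι : Type*} [Finite ι] [Nonempty ι] :
    Continuous fun d : ι → ℝ => ⨅ i, d i := by
  have := Fintype.ofFinite ι
  simp only [← Finset.inf'_univ_eq_ciInf]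
  exact Continuous.finset_inf'_apply _ fun i _ => continuous_apply i

lemma measurable_apexX : Measurable apexX := by
  unfold apexX
  have := (continuous_iInf_real (ι := Fin 3)).measurable
  fun_prop

lemma continuousAt_apexX {d : Fin 3 → ℝ} (hd : d ≠ 0) : ContinuousAt apexX d := by
  have := continuous_iInf_real (ι := Fin 3)
  unfold apexX
  exact ContinuousAt.div (by fun_prop) (by fun_prop) (by positivity)

lemma sideLengths_lineMap {u v s : ℝ} (h : u ≤ v) (hs : s ∈ Set.Icc (0 : ℝ) 1) :
    sideLengths ![u, AffineMap.lineMap u v s, v] = (v - u) • ![1 - s, 1, s] := by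
  have huv : dist u v = v - u := by rw [dist_comm, Real.dist_eq, abs_of_nonneg (sub_nonneg.2 h)]
  ext i
  fin_cases i
  · simp [sideLengths, dist_lineMap_right, huv, abs_of_nonneg (sub_nonneg.2 hs.2), mul_comm]
  · simp [sideLengths, dist_comm v u, huv]
  · simp [sideLengths, dist_left_lineMap, huv, abs_of_nonneg hs.1, mul_comm]

lemma norm_vec_one_sub {s : ℝ} (hs : s ∈ Set.Icc (0 : ℝ) 1) : ‖![1 - s, 1, s]‖ = 1 := by
  simp [norm_fin_three, abs_of_nonneg, hs.1, hs.2]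

lemma apexX_vec_one_sub {s : ℝ} (hs : s ∈ Set.Icc (0 : ℝ) 1) :
    apexX ![1 - s, 1, s] = max s (1 - s) := by
  rw [apexX, norm_vec_one_sub hs, iInf_fin_three, Fin.sum_univ_three]
  rcases le_total s (1 - s) with h | h
  · simp only [Matrix.cons_val, min_eq_right hs.2, min_eq_right h, max_eq_right h]
    ring
  · simp only [Matrix.cons_val, min_eq_right hs.2, min_eq_left h, max_eq_left h]
    ring

lemma norm_sideLengths_eq_sub {p q r : ℝ} (hpq : p ≤ q) (hqr : q ≤ r) :
    ‖sideLengths ![r, p, q]‖ = r - p := by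
  have hdist {a b : ℝ} (h : a ≤ b) : |dist a b| = b - a := by
    rw [abs_of_nonneg dist_nonneg, dist_comm, Real.dist_eq, abs_of_nonneg (sub_nonneg.2 h)]
  have h0 : |sideLengths ![r, p, q] 0| = q - p := hdist hpq
  have h1 : |sideLengths ![r, p, q] 1| = r - q := hdist hqr
  have h2 : |sideLengths ![r, p, q] 2| = r - p := by
    rw [← hdist (hpq.trans hqr), dist_comm]
    rfl
  rw [norm_fin_three, h0, h1, h2, max_eq_right (sub_le_sub_left hpq r),
    max_eq_right (sub_le_sub_right hqr p)]

lemma exists_perm_comp_eq_sorted (q : Fin 3 → ℝ) :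
    ∃ (σ : Equiv.Perm (Fin 3)) (a b c : ℝ), a ≤ b ∧ b ≤ c ∧ q ∘ σ = ![c, a, b] := by
  have hmono := Tuple.monotone_sort q
  refine ⟨(Equiv.addRight 2).trans (Tuple.sort q), _, _, _, hmono (show (0 : Fin 3) ≤ 1 by decide),
    hmono (show (1 : Fin 3) ≤ 2 by decide), ?_⟩
  ext i
  fin_cases i <;> rfl

/-- The law of the triple whose `i`-th entry is uniform on the segment opposite to `q i`, the
entries being independent: the random subdivision of a degenerate triangle `q` on the line. -/
noncomputable def subdivisionLaw (q : Fin 3 → ℝ) : Measure (Fin 3 → ℝ) :=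
  Measure.pi fun i => segmentUniform (q (i + 1)) (q (i + 2))

instance (q : Fin 3 → ℝ) : IsProbabilityMeasure (subdivisionLaw q) := by
  unfold subdivisionLaw
  infer_instance

lemma map_comp_perm_subdivisionLaw (q : Fin 3 → ℝ) (σ : Equiv.Perm (Fin 3)) :
    (subdivisionLaw q).map (· ∘ σ) = subdivisionLaw (q ∘ σ) := by
  rw [subdivisionLaw, pi_map_comp_perm, subdivisionLaw]
  congr 1
  ext1 i
  rcases perm_fin_three_cyclic_or_anticyclic σ with h | h
  · simp only [Function.comp_apply, h]
  · simp only [Function.comp_apply, h]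
    exact segmentUniform_comm _ _

lemma measurable_lintegral_Icc {β : Type*} [MeasurableSpace β] {f g : β → ℝ}
    {F : β → ℝ → ENNReal} (hf : Measurable f) (hg : Measurable g)
    (hF : Measurable (Function.uncurry F)) :
    Measurable fun z => ∫⁻ c in Set.Icc (f z) (g z), F z c := by
  simp_rw [← lintegral_indicator measurableSet_Icc]
  refine Measurable.lintegral_prod_right' (f := fun z : β × ℝ =>
    (Set.Icc (f z.1) (g z.1)).indicator (F z.1) z.2) ?_
  convert hF.indicator ((measurableSet_le (hf.comp measurable_fst) measurable_snd).inter
    (measurableSet_le measurable_snd (hg.comp measurable_fst))) with z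
  simp [Set.indicator_apply, Function.uncurry]

lemma lintegral_lintegral_add_left {α β : Type*} [MeasurableSpace α] [MeasurableSpace β]
    {μ : Measure α} {ν : Measure β} [SFinite ν] {f : α → β → ENNReal}
    (hf : Measurable (Function.uncurry f)) (g : α → β → ENNReal) :
    ∫⁻ a, ∫⁻ b, f a b + g a b ∂ν ∂μ = (∫⁻ a, ∫⁻ b, f a b ∂ν ∂μ) + ∫⁻ a, ∫⁻ b, g a b ∂ν ∂μ := by
  rw [← lintegral_add_left hf.lintegral_prod_right]
  exact lintegral_congr fun a => lintegral_add_left hf.of_uncurry_left _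

lemma ofReal_mul_lintegral_subdivisionLaw {p q r : ℝ} (hpq : p ≤ q) (hqr : q ≤ r)
    {Φ : (Fin 3 → ℝ) → ENNReal} (hΦ : Measurable Φ) :
    ENNReal.ofReal (r - p) * ∫⁻ x, Φ x ∂subdivisionLaw ![r, p, q] =
      (∫⁻ v, ∫⁻ u, (∫⁻ c in Set.Icc p q, Φ ![u, v, c])
          ∂segmentUniform p q ∂segmentUniform q r) +
        ∫⁻ u, ∫⁻ v, (∫⁻ c in Set.Icc q r, Φ ![u, v, c])
          ∂segmentUniform q r ∂segmentUniform p q := by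
  have hp : Measurable (Function.uncurry fun u v => ∫⁻ c in Set.Icc p q, Φ ![u, v, c]) :=
    measurable_lintegral_Icc (F := fun (z : ℝ × ℝ) c => Φ ![z.1, z.2, c])
      measurable_const measurable_const (by simp only [Function.uncurry_def]; fun_prop)
  calc ENNReal.ofReal (r - p) * ∫⁻ x, Φ x ∂subdivisionLaw ![r, p, q]
      = ENNReal.ofReal (r - p) * ∫⁻ u, ∫⁻ v, ∫⁻ c, Φ ![u, v, c]
          ∂segmentUniform p r ∂segmentUniform q r ∂segmentUniform p q := by
        rw [subdivisionLaw, lintegral_pi_fin_three _ hΦ, segmentUniform_comm p r]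
        rfl
    _ = ∫⁻ u, ∫⁻ v, (∫⁻ c in Set.Icc p q, Φ ![u, v, c]) + (∫⁻ c in Set.Icc q r, Φ ![u, v, c])
          ∂segmentUniform q r ∂segmentUniform p q := by
        simp_rw [← lintegral_add_measure, restrict_Icc_add_restrict_Icc hpq hqr,
          ← ofReal_smul_segmentUniform (hpq.trans hqr), lintegral_smul_measure, smul_eq_mul,
          lintegral_const_mul' _ _ ENNReal.ofReal_ne_top]
    _ = _ := by
        rw [lintegral_lintegral_add_left hp, lintegral_lintegral_swap hp.aemeasurable]

section Symmetric

variable {Φ : (Fin 3 → ℝ) → ENNReal}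

-- The third entry falls on one side of `q`, next to one of the other two entries; by symmetry
-- that neighbour may be taken to be the extreme one, at the cost of a factor `2`.
lemma ofReal_mul_lintegral_subdivisionLaw_of_symm {p q r : ℝ} (hpq : p ≤ q) (hqr : q ≤ r)
    (hΦ : Measurable Φ) (hsymm : ∀ x (σ : Equiv.Perm (Fin 3)), Φ (x ∘ σ) = Φ x) :
    ENNReal.ofReal (r - p) * ∫⁻ x, Φ x ∂subdivisionLaw ![r, p, q] =
      2 * ∫⁻ u, ∫⁻ v, (∫⁻ c in Set.Icc u v, Φ ![u, c, v])
        ∂segmentUniform q r ∂segmentUniform p q := by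
  have h02 (u v c) : Φ ![u, v, c] = Φ ![c, v, u] := by
    rw [← hsymm _ (Equiv.swap 0 2)]
    congr 1
    ext i; fin_cases i <;> rfl
  have h12 (u v c) : Φ ![u, v, c] = Φ ![u, c, v] := by
    rw [← hsymm _ (Equiv.swap 1 2)]
    congr 1
    ext i; fin_cases i <;> rfl
  have hleft (v : ℝ) : ∫⁻ u, (∫⁻ c in Set.Icc p q, Φ ![u, v, c]) ∂segmentUniform p q =
      2 * ∫⁻ u, (∫⁻ c in Set.Icc u q, Φ ![u, v, c]) ∂segmentUniform p q :=
    lintegral_segmentUniform_lintegral_Icc_eq_right hpq (g := fun u c => Φ ![u, v, c])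
      (by simp only [Function.uncurry_def]; fun_prop) fun u c => h02 u v c
  have hright (u : ℝ) : ∫⁻ v, (∫⁻ c in Set.Icc q r, Φ ![u, v, c]) ∂segmentUniform q r =
      2 * ∫⁻ v, (∫⁻ c in Set.Icc q v, Φ ![u, v, c]) ∂segmentUniform q r :=
    lintegral_segmentUniform_lintegral_Icc_eq_left hqr (g := fun v c => Φ ![u, v, c])
      (by simp only [Function.uncurry_def]; fun_prop) fun v c => h12 u v c
  have hmeas : Measurable (Function.uncurry fun u v => ∫⁻ c in Set.Icc u q, Φ ![u, v, c]) :=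
    measurable_lintegral_Icc (F := fun (z : ℝ × ℝ) c => Φ ![z.1, z.2, c])
      measurable_fst measurable_const (by simp only [Function.uncurry_def]; fun_prop)
  simp_rw [ofReal_mul_lintegral_subdivisionLaw hpq hqr hΦ, hleft, hright]
  rw [lintegral_const_mul' _ _ ENNReal.ofNat_ne_top, lintegral_const_mul' _ _ ENNReal.ofNat_ne_top,
    ← mul_add, ← lintegral_lintegral_swap hmeas.aemeasurable, ← lintegral_lintegral_add_left hmeas]
  congr 1
  refine lintegral_congr_ae ?_
  filter_upwards [ae_segmentUniform_mem_Icc hpq] with u hu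
  refine lintegral_congr_ae ?_
  filter_upwards [ae_segmentUniform_mem_Icc hqr] with v hv
  rw [← lintegral_add_measure, restrict_Icc_add_restrict_Icc hu.2 hv.1]
  simp_rw [h12]

lemma ofReal_mul_lintegral_sideLengths_subdivisionLaw {p q r : ℝ} (hpq : p ≤ q) (hqr : q ≤ r)
    (hΦ : Measurable Φ) (hsymm : ∀ x (σ : Equiv.Perm (Fin 3)), Φ (x ∘ σ) = Φ x) :
    ENNReal.ofReal (r - p) * ∫⁻ x, Φ (sideLengths x) ∂subdivisionLaw ![r, p, q] =
      2 * ∫⁻ u, ∫⁻ v, ENNReal.ofReal (v - u) * (∫⁻ s, Φ ((v - u) • ![1 - s, 1, s]) ∂unitUniform)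
        ∂segmentUniform q r ∂segmentUniform p q := by
  have hmeas : Measurable fun x : Fin 3 → ℝ => Φ (sideLengths x) := hΦ.comp measurable_sideLengths
  rw [ofReal_mul_lintegral_subdivisionLaw_of_symm hpq hqr hmeas
    fun x σ => by rw [sideLengths_comp_perm, hsymm]]
  congr 1
  refine lintegral_congr_ae ?_
  filter_upwards [ae_segmentUniform_mem_Icc hpq] with u hu
  refine lintegral_congr_ae ?_
  filter_upwards [ae_segmentUniform_mem_Icc hqr] with v hv
  have huv : u ≤ v := hu.2.trans hv.1
  refine (lintegral_Icc huv (hmeas.comp (f := fun c => ![u, c, v]) (by fun_prop))).trans ?_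
  congr 1
  refine lintegral_congr_ae ?_
  filter_upwards [ae_restrict_mem measurableSet_Icc] with s hs
  rw [Function.comp_apply, sideLengths_lineMap huv hs]

lemma lintegral_subdivisionLaw_comp_perm (q : Fin 3 → ℝ) (σ : Equiv.Perm (Fin 3))
    (hΦ : Measurable Φ) (hsymm : ∀ x (τ : Equiv.Perm (Fin 3)), Φ (x ∘ τ) = Φ x) :
    ∫⁻ x, Φ x ∂subdivisionLaw (q ∘ σ) = ∫⁻ x, Φ x ∂subdivisionLaw q := by
  rw [← map_comp_perm_subdivisionLaw, lintegral_map hΦ (by fun_prop)]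
  simp_rw [hsymm]

end Symmetric

-- The measure `ν` is the law of the distance between the entries on the two shorter sides; the law
-- of the longest new side is `ν` biased by the length.
lemma exists_lintegral_sideLengths_subdivisionLaw_eq (q : Fin 3 → ℝ) :
    ∃ ν : Measure ℝ, IsProbabilityMeasure ν ∧ ∀ Φ : (Fin 3 → ℝ) → ENNReal, Measurable Φ →
      (∀ x (σ : Equiv.Perm (Fin 3)), Φ (x ∘ σ) = Φ x) →
      ENNReal.ofReal ‖sideLengths q‖ * ∫⁻ x, Φ (sideLengths x) ∂subdivisionLaw q =
        2 * ∫⁻ w, ENNReal.ofReal w * (∫⁻ s, Φ (w • ![1 - s, 1, s]) ∂unitUniform) ∂ν := by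
  obtain ⟨σ, p, m, r, hpm, hmr, hsort⟩ := exists_perm_comp_eq_sorted q
  have hsub : Measurable fun z : ℝ × ℝ => z.2 - z.1 := by fun_prop
  refine ⟨((segmentUniform p m).prod (segmentUniform m r)).map fun z => z.2 - z.1,
    Measure.isProbabilityMeasure_map hsub.aemeasurable, fun Φ hΦ hsymm => ?_⟩
  have hmeas : Measurable fun w : ℝ =>
      ENNReal.ofReal w * ∫⁻ s, Φ (w • ![1 - s, 1, s]) ∂unitUniform :=
    ENNReal.measurable_ofReal.mul <| Measurable.lintegral_prod_right' <|
      hΦ.comp (g := Φ) (f := fun z : ℝ × ℝ => z.1 • ![1 - z.2, 1, z.2]) (by fun_prop)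
  have hperm : ∫⁻ x, Φ (sideLengths x) ∂subdivisionLaw (q ∘ σ) =
      ∫⁻ x, Φ (sideLengths x) ∂subdivisionLaw q :=
    lintegral_subdivisionLaw_comp_perm q σ (Φ := fun x => Φ (sideLengths x))
      (hΦ.comp measurable_sideLengths) fun x τ => by rw [sideLengths_comp_perm, hsymm]
  rw [← norm_comp_perm _ σ, ← sideLengths_comp_perm, ← hperm, hsort,
    norm_sideLengths_eq_sub hpm hmr,
    ofReal_mul_lintegral_sideLengths_subdivisionLaw hpm hmr hΦ hsymm, lintegral_map hmeas hsub]
  exact congrArg (2 * ·) (lintegral_prod _ (hmeas.comp hsub).aemeasurable).symm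

lemma map_apexX_sideLengths_subdivisionLaw {q : Fin 3 → ℝ} (hq : sideLengths q ≠ 0) :
    (subdivisionLaw q).map (apexX ∘ sideLengths) =
      unitUniform.map fun s => max s (1 - s) := by
  obtain ⟨ν, -, hlaw⟩ := exists_lintegral_sideLengths_subdivisionLaw_eq q
  have hwidth : ENNReal.ofReal ‖sideLengths q‖ = 2 * ∫⁻ w, ENNReal.ofReal w ∂ν := by
    simpa using hlaw 1 measurable_one fun _ _ => rfl
  refine Measure.ext_of_lintegral _ fun f hf => ?_
  have hshape (w : ℝ) :
      ENNReal.ofReal w * (∫⁻ s, f (apexX (w • ![1 - s, 1, s])) ∂unitUniform) =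
        ENNReal.ofReal w * ∫⁻ s, f (max s (1 - s)) ∂unitUniform := by
    rcases le_or_gt w 0 with hw | hw
    · simp [ENNReal.ofReal_of_nonpos hw]
    · congr 1
      refine lintegral_congr_ae ?_
      filter_upwards [ae_restrict_mem measurableSet_Icc] with s hs
      rw [apexX_smul hw, apexX_vec_one_sub hs]
  rw [lintegral_map hf (measurable_apexX.comp measurable_sideLengths),
    lintegral_map hf (by fun_prop),
    ← ENNReal.mul_right_inj (a := ENNReal.ofReal ‖sideLengths q‖) (by simpa using hq)
      ENNReal.ofReal_ne_top]
  calc ENNReal.ofReal ‖sideLengths q‖ * ∫⁻ x, f (apexX (sideLengths x)) ∂subdivisionLaw q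
      = 2 * ∫⁻ w, ENNReal.ofReal w *
          (∫⁻ s, f (apexX (w • ![1 - s, 1, s])) ∂unitUniform) ∂ν :=
        hlaw (fun d => f (apexX d)) (hf.comp measurable_apexX) fun x σ => by rw [apexX_comp_perm]
    _ = ENNReal.ofReal ‖sideLengths q‖ * ∫⁻ s, f (max s (1 - s)) ∂unitUniform := by
        simp_rw [hshape]
        rw [lintegral_mul_const _ ENNReal.measurable_ofReal, hwidth, mul_assoc]

lemma lintegral_inv_norm_sideLengths_subdivisionLaw_le (q : Fin 3 → ℝ) :
    ∫⁻ x, (ENNReal.ofReal ‖sideLengths x‖)⁻¹ ∂subdivisionLaw q ≤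
      2 * (ENNReal.ofReal ‖sideLengths q‖)⁻¹ := by
  obtain ⟨ν, hν, hlaw⟩ := exists_lintegral_sideLengths_subdivisionLaw_eq q
  have hinner (w : ℝ) : ENNReal.ofReal w *
      (∫⁻ s, (ENNReal.ofReal ‖w • ![1 - s, 1, s]‖)⁻¹ ∂unitUniform) ≤ 1 := by
    rcases le_or_gt w 0 with hw | hw
    · simp [ENNReal.ofReal_of_nonpos hw]
    · have hconst : ∀ᵐ s ∂unitUniform,
          (ENNReal.ofReal ‖w • ![1 - s, 1, s]‖)⁻¹ = (ENNReal.ofReal w)⁻¹ := by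
        filter_upwards [ae_restrict_mem measurableSet_Icc] with s hs
        rw [norm_smul, norm_vec_one_sub hs, mul_one, Real.norm_of_nonneg hw.le]
      rw [lintegral_congr_ae hconst, lintegral_const, measure_univ, mul_one]
      exact ENNReal.mul_inv_le_one _
  rcases eq_or_ne (ENNReal.ofReal ‖sideLengths q‖) 0 with h0 | h0
  · simp [h0]
  rw [← div_eq_mul_inv, ENNReal.le_div_iff_mul_le (.inl h0) (.inl ENNReal.ofReal_ne_top), mul_comm,
    hlaw (fun d => (ENNReal.ofReal ‖d‖)⁻¹) (by fun_prop) fun d σ => by rw [norm_comp_perm]]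
  refine mul_le_of_le_one_right' ((lintegral_mono hinner).trans ?_)
  simp

lemma map_max_one_sub_unitUniform :
    unitUniform.map (fun s => max s (1 - s)) = volume[|Set.Icc (1 / 2 : ℝ) 1] := by
  have hmax : Measurable fun s : ℝ => max s (1 - s) := by fun_prop
  have hright : (volume.restrict (Set.Icc (1 / 2 : ℝ) 1)).map (fun s => max s (1 - s)) =
      volume.restrict (Set.Icc (1 / 2) 1) := by
    refine (Measure.map_congr (g := id) ?_).trans Measure.map_id
    filter_upwards [ae_restrict_mem measurableSet_Icc] with s hs
    exact max_eq_left (by linarith [hs.1])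
  have hleft : (volume.restrict (Set.Icc (0 : ℝ) (1 / 2))).map (fun s => max s (1 - s)) =
      volume.restrict (Set.Icc (1 / 2) 1) := by
    have hreflect := ((Measure.measurePreserving_sub_left (volume : Measure ℝ) 1).restrict_preimage
      (s := Set.Icc (1 / 2 : ℝ) 1) measurableSet_Icc).map_eq
    rw [Set.preimage_const_sub_Icc, sub_self, sub_half] at hreflect
    refine (Measure.map_congr ?_).trans hreflect
    filter_upwards [ae_restrict_mem measurableSet_Icc] with s hs
    exact max_eq_right (by linarith [hs.2])
  rw [unitUniform, ← restrict_Icc_add_restrict_Icc (q := 1 / 2) (by norm_num) (by norm_num),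
    Measure.map_add _ _ hmax, hleft, hright, ProbabilityTheory.cond, Real.volume_Icc, sub_half,
    one_div, ENNReal.ofReal_inv_of_pos two_pos, inv_inv, ENNReal.ofReal_ofNat, two_smul]

/-- The uniform distribution on the cube `[0, 1]³`. -/
noncomputable def cubeUniform : Measure (Fin 3 → ℝ) := Measure.pi fun _ => unitUniform

instance : IsProbabilityMeasure cubeUniform := by
  unfold cubeUniform
  infer_instance

lemma map_lineMap_cubeUniform (q : Fin 3 → ℝ) :
    cubeUniform.map (fun t i => AffineMap.lineMap (q (i + 1)) (q (i + 2)) (t i)) =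
      subdivisionLaw q :=
  Measure.pi_map_pi fun _ => (measurable_lineMap _ _).aemeasurable

lemma ae_cubeUniform_mem_Ioo : ∀ᵐ t ∂cubeUniform, ∀ i, t i ∈ Set.Ioo (0 : ℝ) 1 := by
  have hunit : ∀ᵐ s ∂unitUniform, s ∈ Set.Ioo (0 : ℝ) 1 := by
    rw [unitUniform, ← restrict_Ioo_eq_restrict_Icc]
    exact ae_restrict_mem measurableSet_Ioo
  exact ae_all_iff.2 fun i =>
    (measurePreserving_eval (fun _ : Fin 3 => unitUniform) i).quasiMeasurePreserving.ae hunit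

lemma integrable_cubeUniform_of_continuous {f : (Fin 3 → ℝ) → ℝ} (hf : Continuous f) :
    Integrable f cubeUniform := by
  have hcube : cubeUniform = volume.restrict (Set.Icc 0 1) := by
    rw [cubeUniform, volume_pi, ← Set.pi_univ_Icc, Measure.restrict_pi_pi]
    rfl
  rw [hcube]
  exact hf.integrableOn_Icc

lemma integral_prod_cubeUniform (f : ℝ → ℝ) :
    ∫ t, ∏ i, f (t i) ∂cubeUniform = (∫ s in (0 : ℝ)..1, f s) ^ 3 := by
  rw [cubeUniform, integral_fintype_prod_eq_prod (fun _ => f), Finset.prod_const, Finset.card_fin,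
    intervalIntegral.integral_of_le zero_le_one, unitUniform, integral_Icc_eq_integral_Ioc]

/-- The ratio of the area of `subtriangle T t` to the area of `T`. -/
noncomputable def areaRatio (t : Fin 3 → ℝ) : ℝ := ∏ i, t i + ∏ i, (1 - t i)

lemma areaRatio_pos {t : Fin 3 → ℝ} (ht : ∀ i, t i ∈ Set.Ioo (0 : ℝ) 1) : 0 < areaRatio t :=
  add_pos (Finset.prod_pos fun i _ => (ht i).1) (Finset.prod_pos fun i _ => sub_pos.2 (ht i).2)

lemma areaRatio_le_one {t : Fin 3 → ℝ} (ht : ∀ i, t i ∈ Set.Icc (0 : ℝ) 1) : areaRatio t ≤ 1 := by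
  have hle : ∏ i, t i ≤ t 0 := by
    rw [Fin.prod_univ_succ]
    exact mul_le_of_le_one_right (ht 0).1
      (Finset.prod_le_one (fun i _ => (ht _).1) fun i _ => (ht _).2)
  have hle' : ∏ i, (1 - t i) ≤ 1 - t 0 := by
    rw [Fin.prod_univ_succ]
    exact mul_le_of_le_one_right (sub_nonneg.2 (ht 0).2)
      (Finset.prod_le_one (fun i _ => sub_nonneg.2 (ht _).2) fun i _ => sub_le_self _ (ht _).1)
  rw [areaRatio]
  linarith

lemma continuous_areaRatio : Continuous areaRatio := by
  unfold areaRatio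
  fun_prop

lemma integral_areaRatio : ∫ t, areaRatio t ∂cubeUniform = 1 / 4 := by
  simp only [areaRatio]
  rw [integral_add (integrable_cubeUniform_of_continuous (by fun_prop))
    (integrable_cubeUniform_of_continuous (by fun_prop)), integral_prod_cubeUniform fun s => s,
    integral_prod_cubeUniform fun s => 1 - s, intervalIntegral.integral_comp_sub_left fun s => s]
  norm_num

lemma integral_areaRatio_sq : ∫ t, areaRatio t ^ 2 ∂cubeUniform = 1 / 12 := by
  have hexpand (t : Fin 3 → ℝ) : areaRatio t ^ 2 =
      ∏ i, t i ^ 2 + ∏ i, (1 - t i) ^ 2 + 2 * ∏ i, t i * (1 - t i) := by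
    rw [areaRatio, Finset.prod_pow, Finset.prod_pow, Finset.prod_mul_distrib]
    ring
  have hsq : ∫ s in (0 : ℝ)..1, (1 - s) ^ 2 = 1 / 3 := by
    rw [intervalIntegral.integral_comp_sub_left fun s => s ^ 2]
    norm_num
  have hmul : ∫ s in (0 : ℝ)..1, s * (1 - s) = 1 / 6 := by
    simp_rw [mul_one_sub, ← sq]
    rw [intervalIntegral.integral_sub (by simp) (by simp)]
    norm_num
  simp_rw [hexpand]
  rw [integral_add (integrable_cubeUniform_of_continuous (by fun_prop))
      (integrable_cubeUniform_of_continuous (by fun_prop)),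
    integral_add (integrable_cubeUniform_of_continuous (by fun_prop))
      (integrable_cubeUniform_of_continuous (by fun_prop)), integral_const_mul,
    integral_prod_cubeUniform fun s => s ^ 2, integral_prod_cubeUniform fun s => (1 - s) ^ 2,
    integral_prod_cubeUniform fun s => s * (1 - s), hsq, hmul]
  norm_num

lemma sqrt_le_quadratic {x : ℝ} (hx0 : 0 ≤ x) (hx1 : x ≤ 1) :
    √x ≤ x + 1 / 4 - 4 / 9 * (x - 1 / 4) ^ 2 := by
  obtain ⟨s, hs0, rfl⟩ : ∃ s, 0 ≤ s ∧ s ^ 2 = x := ⟨√x, Real.sqrt_nonneg x, Real.sq_sqrt hx0⟩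
  have hs1 : s ≤ 1 := by nlinarith
  rw [Real.sqrt_sq hs0, ← sub_nonneg]
  calc 0 ≤ (s - 1 / 2) ^ 2 * (1 - 4 / 9 * (s + 1 / 2) ^ 2) :=
        mul_nonneg (sq_nonneg _) (by nlinarith)
    _ = _ := by ring

-- `√x ≤ x + 1/4` alone would give the bound `1/2`; the quadratic correction makes it strict.
lemma lintegral_sqrt_areaRatio_le :
    ∫⁻ t, ENNReal.ofReal (√(areaRatio t)) ∂cubeUniform ≤ ENNReal.ofReal (53 / 108) := by
  have hratio := integrable_cubeUniform_of_continuous continuous_areaRatio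
  have hratio_sq := integrable_cubeUniform_of_continuous (continuous_areaRatio.fun_pow 2)
  have hsqrt := integrable_cubeUniform_of_continuous (continuous_areaRatio.sqrt)
  have hquad : Integrable (fun t => 11 / 9 * areaRatio t - 4 / 9 * areaRatio t ^ 2) cubeUniform :=
    (hratio.const_mul _).sub (hratio_sq.const_mul _)
  have hexpand (t : Fin 3 → ℝ) : areaRatio t + 1 / 4 - 4 / 9 * (areaRatio t - 1 / 4) ^ 2 =
      11 / 9 * areaRatio t - 4 / 9 * areaRatio t ^ 2 + 2 / 9 := by ring
  rw [← ofReal_integral_eq_lintegral_ofReal hsqrt (ae_of_all _ fun t => Real.sqrt_nonneg _)]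
  refine ENNReal.ofReal_le_ofReal ?_
  calc ∫ t, √(areaRatio t) ∂cubeUniform
      ≤ ∫ t, (11 / 9 * areaRatio t - 4 / 9 * areaRatio t ^ 2 + 2 / 9) ∂cubeUniform := by
        refine integral_mono_ae hsqrt (hquad.add (integrable_const _)) ?_
        filter_upwards [ae_cubeUniform_mem_Ioo] with t ht
        have hle := areaRatio_le_one fun i => Set.Ioo_subset_Icc_self (ht i)
        simpa only [hexpand] using sqrt_le_quadratic (areaRatio_pos ht).le hle
    _ = 53 / 108 := by
        rw [integral_add hquad (integrable_const _),
          integral_sub (hratio.const_mul _) (hratio_sq.const_mul _), integral_const_mul,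
          integral_const_mul, integral_areaRatio, integral_areaRatio_sq]
        norm_num

/-- Twice the signed area of a triangle. -/
noncomputable def areaDet (T : Fin 3 → Plane) : ℝ :=
  (Matrix.of fun i => ![1, T i 0, T i 1]).det

lemma areaDet_eq (T : Fin 3 → Plane) : areaDet T =
    (T 1 0 - T 0 0) * (T 2 1 - T 0 1) - (T 1 1 - T 0 1) * (T 2 0 - T 0 0) := by
  simp only [areaDet, Matrix.det_fin_three, Matrix.of_apply, Matrix.cons_val]
  ring

lemma affineIndependent_iff_areaDet_ne_zero (T : Fin 3 → Plane) :
    AffineIndependent ℝ T ↔ areaDet T ≠ 0 := by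
  rw [areaDet, ne_eq, ← Matrix.exists_vecMul_eq_zero_iff, affineIndependent_iff_of_fintype]
  push Not
  refine forall_congr' fun w => ?_
  have hvec : Matrix.vecMul w (Matrix.of fun i => ![1, T i 0, T i 1]) = 0 ↔
      ∑ i, w i = 0 ∧ ∑ i, w i • T i = 0 := by
    rw [funext_iff, PiLp.ext_iff]
    simp [Fin.forall_fin_succ, Matrix.vecMul, dotProduct]
  constructor
  · intro h hw0 hw
    obtain ⟨hsum, hcomb⟩ := hvec.1 hw
    rw [← Finset.univ.weightedVSub_eq_linear_combination hsum] at hcomb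
    exact hw0 (funext (h hsum hcomb))
  · intro h hsum hcomb
    rw [Finset.univ.weightedVSub_eq_linear_combination hsum] at hcomb
    by_contra! hw
    exact h (fun h0 => by simp [h0] at hw) (hvec.2 ⟨hsum, hcomb⟩)

lemma exists_ne_of_areaDet_ne_zero {T : Fin 3 → Plane} (hT : areaDet T ≠ 0) :
    ∃ i j, T i ≠ T j :=
  ⟨0, 1, ((affineIndependent_iff_areaDet_ne_zero T).2 hT).injective.ne (by decide)⟩

lemma subtriangle_apply (T : Fin 3 → Plane) (t : Fin 3 → ℝ) (i : Fin 3) (j : Fin 2) :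
    subtriangle T t i j = AffineMap.lineMap (T (i + 1) j) (T (i + 2) j) (t i) := by
  simp [subtriangle, AffineMap.lineMap_apply]

lemma areaDet_subtriangle (T : Fin 3 → Plane) (t : Fin 3 → ℝ) :
    areaDet (subtriangle T t) = areaRatio t * areaDet T := by
  simp only [areaDet_eq, subtriangle_apply, AffineMap.lineMap_apply_ring', areaRatio,
    Fin.prod_univ_three, Fin.isValue, Fin.reduceAdd, zero_add]
  ring

lemma abs_cross_sides_le_abs_areaDet (T : Fin 3 → Plane) (i j : Fin 3) :
    |(T (i + 2) - T (i + 1)) 0 * (T (j + 2) - T (j + 1)) 1 -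
      (T (j + 2) - T (j + 1)) 0 * (T (i + 2) - T (i + 1)) 1| ≤ |areaDet T| := by
  have hscale (c : ℝ) (hc : |c| ≤ 1) (x : ℝ) (hx : x = c * areaDet T) : |x| ≤ |areaDet T| := by
    rw [hx, abs_mul]
    exact mul_le_of_le_one_left (abs_nonneg _) hc
  fin_cases i <;> fin_cases j <;>
    simp only [areaDet_eq, PiLp.sub_apply, Fin.zero_eta, Fin.mk_one, Fin.reduceFinMk, Fin.isValue,
      Fin.reduceAdd, zero_add] at hscale ⊢ <;> first
    | (refine hscale 0 (by simp) _ ?_; ring1)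
    | (refine hscale 1 (by simp) _ ?_; ring1)
    | (refine hscale (-1) (by simp) _ ?_; ring1)

lemma abs_norm_sub_le_of_cross {e f : Plane} (he : e 0 ≠ 0) :
    |(‖f‖ - ‖e‖ / |e 0| * |f 0|)| ≤ |e 0 * f 1 - f 0 * e 1| / |e 0| := by
  have hproj : ‖(f 0 / e 0) • e‖ = ‖e‖ / |e 0| * |f 0| := by
    rw [norm_smul, Real.norm_eq_abs, abs_div]
    ring
  have hdiff : ‖f - (f 0 / e 0) • e‖ = |e 0 * f 1 - f 0 * e 1| / |e 0| := by
    have hzero : f 0 - f 0 / e 0 * e 0 = 0 := by rw [div_mul_cancel₀ _ he, sub_self]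
    have hone : f 1 - f 0 / e 0 * e 1 = (e 0 * f 1 - f 0 * e 1) / e 0 := by field_simp
    simp [EuclideanSpace.norm_eq, Fin.sum_univ_two, hzero, hone, Real.sqrt_sq_eq_abs, abs_div]
  rw [← hproj, ← hdiff]
  exact abs_norm_sub_norm_le _ _

/-- The degenerate triangle on the line obtained by projecting a triangle to the first axis. -/
def firstCoords (T : Fin 3 → Plane) : Fin 3 → ℝ := fun i => T i 0

/-- The length of the projection of a triangle to the first axis. -/
noncomputable abbrev width (T : Fin 3 → Plane) : ℝ := ‖sideLengths (firstCoords T)‖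

lemma sideLengths_firstCoords_ne_zero {T : Fin 3 → Plane} (hT : areaDet T ≠ 0) :
    sideLengths (firstCoords T) ≠ 0 := by
  contrapose! hT
  have h01 : T 0 0 = T 1 0 := dist_eq_zero.1 (congrFun hT 2)
  have h20 : T 2 0 = T 0 0 := dist_eq_zero.1 (congrFun hT 1)
  rw [areaDet_eq, h20, h01, sub_self, zero_mul, mul_zero, sub_self]

lemma firstCoords_subtriangle (T : Fin 3 → Plane) (t : Fin 3 → ℝ) :
    firstCoords (subtriangle T t) =
      fun i => AffineMap.lineMap (firstCoords T (i + 1)) (firstCoords T (i + 2)) (t i) :=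
  funext fun i => subtriangle_apply T t i 0

lemma measurable_firstCoords : Measurable firstCoords := by
  unfold firstCoords
  fun_prop

lemma exists_norm_sideLengths_sub_smul_le {T : Fin 3 → Plane}
    (hT : sideLengths (firstCoords T) ≠ 0) :
    ∃ k ≥ (1 : ℝ), ‖sideLengths T - k • sideLengths (firstCoords T)‖ ≤
      |areaDet T| / width T := by
  obtain ⟨i, hi⟩ := Finite.exists_max (sideLengths (firstCoords T))
  have hside (j : Fin 3) :
      sideLengths (firstCoords T) j = |(T (j + 2) - T (j + 1)) 0| := by
    rw [sideLengths, dist_comm, Real.dist_eq]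
    rfl
  set e := T (i + 2) - T (i + 1)
  have hwidth : width T = |e 0| := by
    rw [← hside]
    refine le_antisymm ((pi_norm_le_iff_of_nonneg dist_nonneg).2 fun j => ?_)
      ((le_abs_self _).trans (norm_le_pi_norm (sideLengths (firstCoords T)) i))
    exact (Real.norm_of_nonneg dist_nonneg).trans_le (hi j)
  have he : e 0 ≠ 0 := by rwa [← abs_pos, ← hwidth, norm_pos_iff]
  refine ⟨‖e‖ / |e 0|, (one_le_div (abs_pos.2 he)).2 (PiLp.norm_apply_le e 0), ?_⟩
  rw [hwidth]
  refine (pi_norm_le_iff_of_nonneg (by positivity)).2 fun j => ?_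
  have hdist : sideLengths T j = ‖T (j + 2) - T (j + 1)‖ := by
    rw [sideLengths, dist_comm, dist_eq_norm]
  rw [Pi.sub_apply, Pi.smul_apply, smul_eq_mul, hside, hdist]
  exact (abs_norm_sub_le_of_cross he).trans
    (div_le_div_of_nonneg_right (abs_cross_sides_le_abs_areaDet T i j) (abs_nonneg _))

lemma normalizedX_eq_apexX_sideLengths {T : Fin 3 → Plane} (hT : ∃ i j, T i ≠ T j) :
    normalizedX T = apexX (sideLengths T) := by
  obtain ⟨x, y, h⟩ := exists_isNormalizedApex hT
  rw [h.normalizedX_eq, h.x_eq, apexX, iInf_fin_three, norm_fin_three, Fin.sum_univ_three]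
  simp only [sideLengths, abs_of_nonneg dist_nonneg]
  rfl

lemma exists_forall_abs_apexX_sub_lt {δ : ℝ} (hδ : 0 < δ) :
    ∃ ε > 0, ∀ d d' : Fin 3 → ℝ, d' ≠ 0 → ‖d - d'‖ < ε * ‖d'‖ → |apexX d - apexX d'| < δ := by
  have hunif := (isCompact_sphere (0 : Fin 3 → ℝ) 1).uniformContinuousAt_of_continuousAt apexX
    (fun d hd => continuousAt_apexX (ne_zero_of_mem_unit_sphere ⟨d, hd⟩))
    (Metric.dist_mem_uniformity hδ)
  obtain ⟨ε, hε, h⟩ := Metric.mem_uniformity_dist.1 hunif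
  refine ⟨ε, hε, fun d d' hd' hdist => ?_⟩
  have hpos : 0 < ‖d'‖ := norm_pos_iff.2 hd'
  have hclose : dist (‖d'‖⁻¹ • d') (‖d'‖⁻¹ • d) < ε := by
    rw [dist_comm, dist_eq_norm, ← smul_sub, norm_smul, norm_inv, norm_norm,
      inv_mul_lt_iff₀ hpos, mul_comm]
    exact hdist
  have hlt : dist (apexX (‖d'‖⁻¹ • d')) (apexX (‖d'‖⁻¹ • d)) < δ :=
    h hclose (by simp [norm_smul, hpos.ne'])
  rwa [apexX_smul (inv_pos.2 hpos), apexX_smul (inv_pos.2 hpos), dist_comm] at hlt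

lemma exists_forall_abs_normalizedX_sub_lt {δ : ℝ} (hδ : 0 < δ) :
    ∃ ε > 0, ∀ T : Fin 3 → Plane, areaDet T ≠ 0 →
      |areaDet T| < ε * width T ^ 2 →
      |normalizedX T - apexX (sideLengths (firstCoords T))| < δ := by
  obtain ⟨ε, hε, h⟩ := exists_forall_abs_apexX_sub_lt hδ
  refine ⟨ε, hε, fun T hT harea => ?_⟩
  have hside := sideLengths_firstCoords_ne_zero hT
  have hpos : 0 < width T := norm_pos_iff.2 hside
  obtain ⟨k, hk, hle⟩ := exists_norm_sideLengths_sub_smul_le hside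
  have hk0 : 0 < k := zero_lt_one.trans_le hk
  rw [normalizedX_eq_apexX_sideLengths (exists_ne_of_areaDet_ne_zero hT),
    ← apexX_smul hk0 (sideLengths (firstCoords T))]
  refine h _ _ (smul_ne_zero hk0.ne' hside) (hle.trans_lt ?_)
  rw [norm_smul, Real.norm_of_nonneg hk0.le, div_lt_iff₀ hpos]
  nlinarith [mul_le_mul_of_nonneg_left hk (mul_pos hε (pow_pos hpos 2)).le]

lemma measurable_areaDet : Measurable areaDet := by
  simp only [funext areaDet_eq]
  fun_prop

lemma measurable_subtriangle {α : Type*} [MeasurableSpace α] {T : α → Fin 3 → Plane}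
    {t : α → Fin 3 → ℝ} (hT : Measurable T) (ht : Measurable t) :
    Measurable fun a => subtriangle (T a) (t a) := by
  unfold subtriangle
  simp only [AffineMap.lineMap_apply_module]
  fun_prop

lemma measurable_triangleSeq (T₀ : Fin 3 → Plane) (n : ℕ) :
    Measurable fun ξ => triangleSeq T₀ ξ n := by
  induction n with
  | zero => exact measurable_const
  | succ n ih => exact measurable_subtriangle ih (measurable_pi_apply n)

lemma triangleSeq_congr (T₀ : Fin 3 → Plane) {ξ ξ' : ℕ → Fin 3 → ℝ} {n : ℕ}
    (h : ∀ k < n, ξ k = ξ' k) : triangleSeq T₀ ξ n = triangleSeq T₀ ξ' n := by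
  induction n with
  | zero => rfl
  | succ n ih =>
    rw [triangleSeq, triangleSeq, ih fun k hk => h k (hk.trans n.lt_succ_self),
      h n n.lt_succ_self]

lemma areaDet_triangleSeq_ne_zero {T₀ : Fin 3 → Plane} (hT₀ : areaDet T₀ ≠ 0)
    {ξ : ℕ → Fin 3 → ℝ} (hξ : ∀ n i, ξ n i ∈ Set.Ioo (0 : ℝ) 1) (n : ℕ) :
    areaDet (triangleSeq T₀ ξ n) ≠ 0 := by
  induction n with
  | zero => exact hT₀
  | succ n ih =>
    rw [triangleSeq, areaDet_subtriangle]
    exact mul_ne_zero (areaRatio_pos (hξ n)).ne' ih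

lemma iIndepFun_curry {ι κ Ω α : Type*} [Countable ι] [Countable κ] [MeasurableSpace Ω]
    [MeasurableSpace α] {P : Measure Ω} {X : ι → κ → Ω → α}
    (hX : iIndepFun (fun p : ι × κ => X p.1 p.2) P) (hm : ∀ i j, AEMeasurable (X i j) P) :
    iIndepFun (fun i ω j => X i j ω) P := by
  have := hX.isProbabilityMeasure
  have (i : ι) (j : κ) : IsProbabilityMeasure (P.map (X i j)) :=
    Measure.isProbabilityMeasure_map (hm i j)
  have hlaw (i : ι) (j : κ) : HasLaw (X i j) (P.map (X i j)) P := ⟨hm i j, rfl⟩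
  have hrow (i : ι) :
      HasLaw (fun ω j => X i j ω) (Measure.infinitePi fun j => P.map (X i j)) P :=
    (hX.precomp (g := fun j => (i, j)) (Prod.mk_right_injective i)).hasLaw_infinitePi (hlaw i)
      (aemeasurable_pi_lambda _ (hm i))
  have hall : HasLaw (fun ω (p : ι × κ) => X p.1 p.2 ω)
      (Measure.infinitePi fun p : ι × κ => P.map (X p.1 p.2)) P :=
    hX.hasLaw_infinitePi (fun p => hlaw p.1 p.2) (aemeasurable_pi_lambda _ fun p => hm p.1 p.2)
  have hcurry : HasLaw (MeasurableEquiv.curry ι κ α)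
      (Measure.infinitePi fun i => Measure.infinitePi fun j => P.map (X i j))
      (Measure.infinitePi fun p : ι × κ => P.map (X p.1 p.2)) :=
    ⟨(MeasurableEquiv.curry ι κ α).measurable.aemeasurable,
      Measure.infinitePi_map_curry fun i j => P.map (X i j)⟩
  exact (iIndepFun_iff_hasLaw_Pi_infinitePi hrow
    (aemeasurable_pi_lambda _ fun i => (hrow i).aemeasurable)).2 (hcurry.comp hall)

lemma cubeUniform_map_firstCoords_subtriangle (T : Fin 3 → Plane) :
    cubeUniform.map (fun t => firstCoords (subtriangle T t)) = subdivisionLaw (firstCoords T) := by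
  simp only [firstCoords_subtriangle, map_lineMap_cubeUniform]

lemma lintegral_sqrt_abs_areaDet_subtriangle_le (T : Fin 3 → Plane) :
    ∫⁻ t, ENNReal.ofReal √|areaDet (subtriangle T t)| ∂cubeUniform ≤
      ENNReal.ofReal (53 / 108) * ENNReal.ofReal √|areaDet T| := by
  have hmul : ∀ᵐ t ∂cubeUniform, ENNReal.ofReal √|areaDet (subtriangle T t)| =
      ENNReal.ofReal √(areaRatio t) * ENNReal.ofReal √|areaDet T| := by
    filter_upwards [ae_cubeUniform_mem_Ioo] with t ht
    rw [areaDet_subtriangle, abs_mul, abs_of_pos (areaRatio_pos ht),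
      Real.sqrt_mul (areaRatio_pos ht).le, ENNReal.ofReal_mul (Real.sqrt_nonneg _)]
  rw [lintegral_congr_ae hmul, lintegral_mul_const' _ _ ENNReal.ofReal_ne_top]
  gcongr
  exact lintegral_sqrt_areaRatio_le

lemma lintegral_inv_width_subtriangle_le (T : Fin 3 → Plane) :
    ∫⁻ t, (ENNReal.ofReal (width (subtriangle T t)))⁻¹ ∂cubeUniform ≤
      2 * (ENNReal.ofReal (width T))⁻¹ := by
  have hmeas : Measurable fun x : Fin 3 → ℝ => (ENNReal.ofReal ‖sideLengths x‖)⁻¹ :=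
    measurable_sideLengths.norm.ennreal_ofReal.inv
  have hstep : Measurable fun t => firstCoords (subtriangle T t) :=
    measurable_firstCoords.comp (measurable_subtriangle measurable_const measurable_id)
  rw [← lintegral_map hmeas hstep, cubeUniform_map_firstCoords_subtriangle]
  exact lintegral_inv_norm_sideLengths_subdivisionLaw_le _

/-- The square root of twice the area of a triangle relative to its width; it is small for
triangles that are nearly indistinguishable from their projection. -/
noncomputable def aspect (T : Fin 3 → Plane) : ENNReal :=
  ENNReal.ofReal √|areaDet T| * (ENNReal.ofReal (width T))⁻¹

lemma measurable_ofReal_sqrt_abs_areaDet :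
    Measurable fun T => ENNReal.ofReal √|areaDet T| :=
  (continuous_abs.measurable.comp measurable_areaDet).sqrt.ennreal_ofReal

lemma measurable_inv_width :
    Measurable fun T : Fin 3 → Plane => (ENNReal.ofReal (width T))⁻¹ :=
  (measurable_sideLengths.comp measurable_firstCoords).norm.ennreal_ofReal.inv

lemma measurable_aspect : Measurable aspect :=
  measurable_ofReal_sqrt_abs_areaDet.mul measurable_inv_width

lemma aspect_ne_top {T : Fin 3 → Plane} (hT : areaDet T ≠ 0) : aspect T ≠ ⊤ :=
  ENNReal.mul_ne_top ENNReal.ofReal_ne_top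
    (ENNReal.inv_ne_top.2 (by simpa using sideLengths_firstCoords_ne_zero hT))

lemma exists_forall_aspect_lt_abs_normalizedX_sub_lt {δ : ℝ} (hδ : 0 < δ) :
    ∃ ε > 0, ∀ T : Fin 3 → Plane, areaDet T ≠ 0 → aspect T < ENNReal.ofReal ε →
      |normalizedX T - apexX (sideLengths (firstCoords T))| < δ := by
  obtain ⟨ε, hε, h⟩ := exists_forall_abs_normalizedX_sub_lt hδ
  refine ⟨√ε, Real.sqrt_pos.2 hε, fun T hT haspect => h T hT ?_⟩
  have hpos : 0 < width T := norm_pos_iff.2 (sideLengths_firstCoords_ne_zero hT)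
  rw [aspect, ← div_eq_mul_inv, ← ENNReal.ofReal_div_of_pos hpos,
    ENNReal.ofReal_lt_ofReal_iff (Real.sqrt_pos.2 hε), div_lt_iff₀ hpos,
    Real.sqrt_lt' (by positivity), mul_pow, Real.sq_sqrt hε.le] at haspect
  exact haspect

/-- The parameters of the successive subdivisions are independent and uniform on the cube. -/
structure IsUniformSubdivision {Ω : Type*} [MeasurableSpace Ω] (X : ℕ → Ω → Fin 3 → ℝ)
    (P : Measure Ω) : Prop where
  iIndepFun : iIndepFun X P
  hasLaw (n : ℕ) : HasLaw (X n) cubeUniform P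

section RandomSubdivision

variable {Ω : Type*} [MeasurableSpace Ω] {P : Measure Ω} {X : ℕ → Ω → Fin 3 → ℝ}
  {T₀ : Fin 3 → Plane}

lemma isUniformSubdivision_of_isUniform {ξ : ℕ → Fin 3 → Ω → ℝ}
    (hindep : ProbabilityTheory.iIndepFun (fun p : ℕ × Fin 3 => ξ p.1 p.2) P)
    (hunif : ∀ n i, pdf.IsUniform (ξ n i) (Set.Icc 0 1) P volume) :
    IsUniformSubdivision (fun n ω i => ξ n i ω) P := by
  have hlaw (n : ℕ) (i : Fin 3) : HasLaw (ξ n i) unitUniform P :=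
    ⟨(hunif n i).aemeasurable (by simp) (by simp),
      (hunif n i).trans (by simp [ProbabilityTheory.cond, unitUniform])⟩
  exact ⟨iIndepFun_curry hindep fun n i => (hlaw n i).aemeasurable, fun n =>
    (hindep.precomp (g := fun i => (n, i)) (Prod.mk_right_injective n)).hasLaw_pi (hlaw n)⟩

namespace IsUniformSubdivision

lemma aemeasurable_triangleSeq (hX : IsUniformSubdivision X P) (n : ℕ) :
    AEMeasurable (fun ω => triangleSeq T₀ (fun k => X k ω) n) P :=
  (measurable_triangleSeq T₀ n).comp_aemeasurable
    (aemeasurable_pi_lambda _ fun k => (hX.hasLaw k).aemeasurable)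

lemma ae_areaDet_triangleSeq_ne_zero (hX : IsUniformSubdivision X P) (hT₀ : areaDet T₀ ≠ 0) :
    ∀ᵐ ω ∂P, ∀ n, areaDet (triangleSeq T₀ (fun k => X k ω) n) ≠ 0 := by
  have hmem : ∀ᵐ ω ∂P, ∀ n i, X n ω i ∈ Set.Ioo (0 : ℝ) 1 :=
    ae_all_iff.2 fun n => ae_of_ae_map (hX.hasLaw n).aemeasurable
      ((hX.hasLaw n).map_eq ▸ ae_cubeUniform_mem_Ioo)
  filter_upwards [hmem] with ω hω n using areaDet_triangleSeq_ne_zero hT₀ hω n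

lemma indepFun_triangleSeq (hX : IsUniformSubdivision X P) (n : ℕ) :
    IndepFun (fun ω => triangleSeq T₀ (fun k => X k ω) n) (X n) P := by
  have hindep := hX.iIndepFun.indepFun_finset₀ (Finset.range n) {n} (by simp)
    fun k => (hX.hasLaw k).aemeasurable
  let past (y : Finset.range n → Fin 3 → ℝ) : Fin 3 → Plane :=
    triangleSeq T₀ (Function.updateFinset 0 (Finset.range n) y) n
  have hpast : Measurable past := (measurable_triangleSeq T₀ n).comp measurable_updateFinset
  have hpast_eq : (fun ω => triangleSeq T₀ (fun k => X k ω) n) =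
      past ∘ fun ω k => X k ω := by
    ext1 ω
    exact triangleSeq_congr T₀ fun k hk => by simp [Function.updateFinset, hk]
  rw [hpast_eq]
  exact hindep.comp hpast (measurable_pi_apply ⟨n, Finset.mem_singleton_self n⟩)

lemma lintegral_triangleSeq_succ (hX : IsUniformSubdivision X P)
    {f : (Fin 3 → Plane) → ENNReal} (hf : Measurable f) (n : ℕ) :
    ∫⁻ ω, f (triangleSeq T₀ (fun k => X k ω) (n + 1)) ∂P =
      ∫⁻ ω, ∫⁻ t, f (subtriangle (triangleSeq T₀ (fun k => X k ω) n) t) ∂cubeUniform ∂P := by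
  have := hX.iIndepFun.isProbabilityMeasure
  have hT := hX.aemeasurable_triangleSeq (T₀ := T₀) n
  have hXn := (hX.hasLaw n).aemeasurable
  have hg : Measurable fun z : (Fin 3 → Plane) × (Fin 3 → ℝ) => f (subtriangle z.1 z.2) :=
    hf.comp (measurable_subtriangle measurable_fst measurable_snd)
  have hprod := (hX.indepFun_triangleSeq (T₀ := T₀) n).map_prod_eq_prod_map_map hT hXn
  rw [(hX.hasLaw n).map_eq] at hprod
  calc ∫⁻ ω, f (triangleSeq T₀ (fun k => X k ω) (n + 1)) ∂P
      = ∫⁻ z, f (subtriangle z.1 z.2)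
          ∂P.map fun ω => (triangleSeq T₀ (fun k => X k ω) n, X n ω) :=
        (lintegral_map' hg.aemeasurable (hT.prodMk hXn)).symm
    _ = _ := by
        rw [hprod, lintegral_prod _ hg.aemeasurable,
          lintegral_map' hg.lintegral_prod_right'.aemeasurable hT]

lemma lintegral_triangleSeq_le (hX : IsUniformSubdivision X P)
    {f : (Fin 3 → Plane) → ENNReal} (hf : Measurable f) {c : ENNReal}
    (h : ∀ T, ∫⁻ t, f (subtriangle T t) ∂cubeUniform ≤ c * f T) (n : ℕ) :
    ∫⁻ ω, f (triangleSeq T₀ (fun k => X k ω) n) ∂P ≤ c ^ n * f T₀ := by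
  have := hX.iIndepFun.isProbabilityMeasure
  induction n with
  | zero => simp [triangleSeq]
  | succ n ih =>
    calc ∫⁻ ω, f (triangleSeq T₀ (fun k => X k ω) (n + 1)) ∂P
        ≤ ∫⁻ ω, c * f (triangleSeq T₀ (fun k => X k ω) n) ∂P := by
          rw [hX.lintegral_triangleSeq_succ hf]
          exact lintegral_mono fun ω => h _
      _ = c * ∫⁻ ω, f (triangleSeq T₀ (fun k => X k ω) n) ∂P :=
          lintegral_const_mul'' c (hf.comp_aemeasurable (hX.aemeasurable_triangleSeq n))
      _ ≤ c * (c ^ n * f T₀) := by gcongr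
      _ = c ^ (n + 1) * f T₀ := by rw [pow_succ', mul_assoc]

lemma hasLaw_triangleSeq_succ {β : Type*} [MeasurableSpace β] {ν : Measure β}
    (hX : IsUniformSubdivision X P) {F : (Fin 3 → Plane) → β} (hF : Measurable F) {n : ℕ}
    (h : ∀ᵐ ω ∂P, cubeUniform.map
      (fun t => F (subtriangle (triangleSeq T₀ (fun k => X k ω) n) t)) = ν) :
    HasLaw (fun ω => F (triangleSeq T₀ (fun k => X k ω) (n + 1))) ν P := by
  have := hX.iIndepFun.isProbabilityMeasure
  have hmeas : AEMeasurable (fun ω => F (triangleSeq T₀ (fun k => X k ω) (n + 1))) P :=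
    hF.comp_aemeasurable (hX.aemeasurable_triangleSeq (n + 1))
  refine ⟨hmeas, ?_⟩
  ext s hs
  have hind : Measurable (s.indicator (1 : β → ENNReal)) := measurable_one.indicator hs
  have hstep (T : Fin 3 → Plane) : Measurable fun t => F (subtriangle T t) :=
    hF.comp (measurable_subtriangle measurable_const measurable_id)
  have hcond : ∀ᵐ ω ∂P, ∫⁻ t, s.indicator 1
      (F (subtriangle (triangleSeq T₀ (fun k => X k ω) n) t)) ∂cubeUniform = ν s := by
    filter_upwards [h] with ω hω
    rw [← lintegral_map hind (hstep _), hω, lintegral_indicator_one hs]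
  calc P.map (fun ω => F (triangleSeq T₀ (fun k => X k ω) (n + 1))) s
      = ∫⁻ ω, s.indicator 1 (F (triangleSeq T₀ (fun k => X k ω) (n + 1))) ∂P := by
        rw [← lintegral_indicator_one hs, lintegral_map' hind.aemeasurable hmeas]
    _ = ∫⁻ ω, ∫⁻ t, s.indicator 1
          (F (subtriangle (triangleSeq T₀ (fun k => X k ω) n) t)) ∂cubeUniform ∂P :=
        hX.lintegral_triangleSeq_succ (f := fun T => s.indicator 1 (F T)) (hind.comp hF) n
    _ = ν s := by rw [lintegral_congr_ae hcond, lintegral_const, measure_univ, mul_one]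

lemma hasLaw_apexX_triangleSeq_succ (hX : IsUniformSubdivision X P) (hT₀ : areaDet T₀ ≠ 0)
    (n : ℕ) :
    HasLaw (fun ω => apexX (sideLengths (firstCoords (triangleSeq T₀ (fun k => X k ω) (n + 1)))))
      volume[|Set.Icc (1 / 2) 1] P := by
  have happly : Measurable (apexX ∘ sideLengths : (Fin 3 → ℝ) → ℝ) :=
    measurable_apexX.comp measurable_sideLengths
  refine hX.hasLaw_triangleSeq_succ (F := fun T => apexX (sideLengths (firstCoords T)))
    (happly.comp measurable_firstCoords) ?_
  filter_upwards [hX.ae_areaDet_triangleSeq_ne_zero hT₀] with ω hω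
  set T := triangleSeq T₀ (fun k => X k ω) n
  calc cubeUniform.map (fun t => apexX (sideLengths (firstCoords (subtriangle T t))))
      = (cubeUniform.map fun t => firstCoords (subtriangle T t)).map (apexX ∘ sideLengths) :=
        (Measure.map_map happly (measurable_firstCoords.comp
          (measurable_subtriangle measurable_const measurable_id))).symm
    _ = unitUniform.map fun s => max s (1 - s) := by
        rw [cubeUniform_map_firstCoords_subtriangle,
          map_apexX_sideLengths_subdivisionLaw (sideLengths_firstCoords_ne_zero (hω n))]
    _ = volume[|Set.Icc (1 / 2) 1] := map_max_one_sub_unitUniform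

lemma lintegral_aspect_triangleSeq_rpow_le (hX : IsUniformSubdivision X P) (n : ℕ) :
    ∫⁻ ω, aspect (triangleSeq T₀ (fun k => X k ω) n) ^ (1 / 2 : ℝ) ∂P ≤
      (ENNReal.ofReal (53 / 54) ^ n * aspect T₀) ^ (1 / 2 : ℝ) := by
  have hhalf : (0 : ℝ) ≤ 1 / 2 := by norm_num
  have hT := hX.aemeasurable_triangleSeq (T₀ := T₀) n
  have hratio : ENNReal.ofReal (53 / 108) * 2 = ENNReal.ofReal (53 / 54) := by
    rw [← ENNReal.ofReal_ofNat 2, ← ENNReal.ofReal_mul (by norm_num)]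
    norm_num
  simp only [aspect, ENNReal.mul_rpow_of_nonneg _ _ hhalf]
  calc _ ≤ _ := ENNReal.lintegral_mul_norm_pow_le
        (measurable_ofReal_sqrt_abs_areaDet.comp_aemeasurable hT)
        (measurable_inv_width.comp_aemeasurable hT) hhalf hhalf (by norm_num)
    _ ≤ (ENNReal.ofReal (53 / 108) ^ n * ENNReal.ofReal √|areaDet T₀|) ^ (1 / 2 : ℝ) *
        (2 ^ n * (ENNReal.ofReal (width T₀))⁻¹) ^ (1 / 2 : ℝ) := by
        gcongr
        · exact hX.lintegral_triangleSeq_le measurable_ofReal_sqrt_abs_areaDet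
            lintegral_sqrt_abs_areaDet_subtriangle_le n
        · exact hX.lintegral_triangleSeq_le measurable_inv_width
            lintegral_inv_width_subtriangle_le n
    _ = _ := by
        rw [← hratio]
        simp only [mul_pow, ENNReal.mul_rpow_of_nonneg _ _ hhalf]
        ring

lemma tendsto_measure_le_aspect_triangleSeq (hX : IsUniformSubdivision X P) (hT₀ : areaDet T₀ ≠ 0)
    {ε : ℝ} (hε : 0 < ε) :
    Tendsto (fun n => P {ω | ENNReal.ofReal ε ≤ aspect (triangleSeq T₀ (fun k => X k ω) n)})
      atTop (nhds 0) := by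
  have hhalf : (0 : ℝ) < 1 / 2 := by norm_num
  have hε0 : ENNReal.ofReal ε ^ (1 / 2 : ℝ) ≠ 0 := by simp [hε]
  have hmarkov (n : ℕ) :
      P {ω | ENNReal.ofReal ε ≤ aspect (triangleSeq T₀ (fun k => X k ω) n)} ≤
        (ENNReal.ofReal (53 / 54) ^ n * aspect T₀) ^ (1 / 2 : ℝ) /
          ENNReal.ofReal ε ^ (1 / 2 : ℝ) := by
    simp only [← ENNReal.rpow_le_rpow_iff hhalf (x := ENNReal.ofReal ε)]
    refine (meas_ge_le_lintegral_div ?_ hε0 ?_).trans ?_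
    · exact (measurable_aspect.comp_aemeasurable (hX.aemeasurable_triangleSeq n)).pow_const _
    · exact ENNReal.rpow_ne_top_of_nonneg hhalf.le ENNReal.ofReal_ne_top
    · gcongr
      exact hX.lintegral_aspect_triangleSeq_rpow_le n
  have hgeom : Tendsto (fun n => ENNReal.ofReal (53 / 54) ^ n * aspect T₀) atTop (nhds 0) := by
    simpa using ENNReal.Tendsto.mul_const (ENNReal.tendsto_pow_atTop_nhds_zero_of_lt_one
      (ENNReal.ofReal_lt_one.2 (by norm_num))) (Or.inr (aspect_ne_top hT₀))
  have hlim : Tendsto (fun n => (ENNReal.ofReal (53 / 54) ^ n * aspect T₀) ^ (1 / 2 : ℝ) /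
      ENNReal.ofReal ε ^ (1 / 2 : ℝ)) atTop (nhds 0) := by
    simpa using ENNReal.Tendsto.div_const (hgeom.ennrpow_const (1 / 2)) (Or.inr hε0)
  exact tendsto_of_tendsto_of_tendsto_of_le_of_le tendsto_const_nhds hlim
    (fun _ => zero_le) hmarkov

lemma tendstoInMeasure_normalizedX_sub_apexX (hX : IsUniformSubdivision X P)
    (hT₀ : areaDet T₀ ≠ 0) :
    TendstoInMeasure P
      ((fun n ω => normalizedX (triangleSeq T₀ (fun k => X k ω) n)) -
        fun n ω => apexX (sideLengths (firstCoords (triangleSeq T₀ (fun k => X k ω) n))))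
      atTop 0 := by
  rw [tendstoInMeasure_iff_norm]
  intro δ hδ
  obtain ⟨ε, hε, h⟩ := exists_forall_aspect_lt_abs_normalizedX_sub_lt hδ
  refine tendsto_of_tendsto_of_tendsto_of_le_of_le tendsto_const_nhds
    (hX.tendsto_measure_le_aspect_triangleSeq hT₀ hε) (fun _ => zero_le) fun n => measure_mono_ae ?_
  filter_upwards [hX.ae_areaDet_triangleSeq_ne_zero hT₀] with ω hω (hle : δ ≤ ‖_ - (0 : ℝ)‖)
  rw [sub_zero, Real.norm_eq_abs] at hle
  by_contra hlt
  exact absurd (h _ (hω n) (not_le.1 hlt)) hle.not_gt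

lemma aemeasurable_normalizedX_triangleSeq (hX : IsUniformSubdivision X P)
    (hT₀ : areaDet T₀ ≠ 0) (n : ℕ) :
    AEMeasurable (fun ω => normalizedX (triangleSeq T₀ (fun k => X k ω) n)) P := by
  refine ((measurable_apexX.comp measurable_sideLengths).comp_aemeasurable
    (hX.aemeasurable_triangleSeq (T₀ := T₀) n)).congr ?_
  filter_upwards [hX.ae_areaDet_triangleSeq_ne_zero hT₀] with ω hω
  exact (normalizedX_eq_apexX_sideLengths (exists_ne_of_areaDet_ne_zero (hω n))).symm

end IsUniformSubdivision

end RandomSubdivision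

theorem theorem5 {Ω Ω' : Type*} [MeasurableSpace Ω] [MeasurableSpace Ω']
    (P : Measure Ω) [IsProbabilityMeasure P] (P' : Measure Ω') [IsProbabilityMeasure P']
    (T₀ : Fin 3 → Plane) (hT₀ : AffineIndependent ℝ T₀)
    (ξ : ℕ → Fin 3 → Ω → ℝ)
    (hξ_indep : iIndepFun (fun p : ℕ × Fin 3 => ξ p.1 p.2) P)
    (hξ_unif : ∀ n i, pdf.IsUniform (ξ n i) (Set.Icc 0 1) P volume)
    (U : Ω' → ℝ) (hU : pdf.IsUniform U (Set.Icc (1 / 2) 1) P' volume) :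
    (∀ᵐ ω ∂P, ∀ n, AffineIndependent ℝ (triangleSeq T₀ (fun k i => ξ k i ω) n)) ∧
    TendstoInDistribution
      (fun n ω => normalizedX (triangleSeq T₀ (fun k i => ξ k i ω) n))
      atTop U (fun _ => P) P' := by
  simp only [affineIndependent_iff_areaDet_ne_zero] at hT₀ ⊢
  have hX := isUniformSubdivision_of_isUniform hξ_indep hξ_unif
  have hlaw := hX.hasLaw_apexX_triangleSeq_succ hT₀
  refine ⟨hX.ae_areaDet_triangleSeq_ne_zero hT₀, ?_⟩
  refine tendstoInDistribution_of_tendstoInMeasure_sub _ U ⟨fun n => ?_, ?_, ?_⟩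
    (hX.tendstoInMeasure_normalizedX_sub_apexX hT₀)
    (hX.aemeasurable_normalizedX_triangleSeq hT₀)
  · exact (measurable_apexX.comp (measurable_sideLengths.comp
      measurable_firstCoords)).comp_aemeasurable (hX.aemeasurable_triangleSeq n)
  · exact hU.aemeasurable (by norm_num [Real.volume_Icc]) (by simp)
  · refine tendsto_const_nhds.congr' ?_
    filter_upwards [eventually_ge_atTop 1] with n hn
    obtain ⟨m, rfl⟩ := Nat.exists_eq_add_of_le' hn
    exact Subtype.ext (hU.trans (hlaw m).map_eq.symm)
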